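/- Let $n>1$, $\tau\in\mathbb C$ with $\operatorname{Im}\tau>0$, and $c,u\in\mathbb C$. For $m,l$ put $\theta_{m,l}(v,\tau)=\sum_{\mu\in m+l\mathbb Z}\exp 2\pi i\bigl(\mu v+\tfrac{\mu^2}{2l}\tau\bigr)$, and let $\theta(v)=\theta_{1/2,1}(v+\tfrac12,\tau)$ (the odd Jacobi theta function), $\theta_j(v)=\theta_{n/2-j,\,n}(v+\tfrac12,\tau)$ for $1\le j\le n$, and $\eta(\tau)$ the Dedekind eta function. Let $\mathfrak h^*=\{\lambda\in\mathbb C^n:\sum_i\lambda_i=0\}$ with the restriction of the bilinear form $\langle\epsilon_i,\epsilon_j\rangle=\delta_{ij}$ of $\mathbb C^n$, let $\bar\epsilon_i=\epsilon_i-\frac1n\sum_k\epsilon_k$, and $\lambda_{i,j}=\langle\lambda,\bar\epsilon_i-\bar\epsilon_j\rangle$. Write $\partial/\partial\bar\epsilon_i$ for the derivative in the direction $\bar\epsilon_i$. For $\lambda\in\mathfrak h^*$ let $\phi(u)_{\lambda,j}^{k}=\theta_j\bigl(\tfrac un-\langle\lambda,\bar\epsilon_k\rangle\bigr)/(\sqrt{-1}\,\eta(\tau))$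 (the $j$-th component of the intertwining vector for the step $\lambda\to\lambda+\hbar\bar\epsilon_k$), and let $[\bar\phi(u)_\lambda^{k,j}]_{k,j}$ be the inverse of the matrix $[\phi(u)_{\lambda,j}^{k}]_{j,k}$. The difference operators $$(L(c|u)^i_jf)(\lambda)=\sum_{k=1}^n\phi(u+c\hbar)_{\lambda,j}^{k}\,\bar\phi(u)_\lambda^{k,i}\,f(\lambda+\hbar\bar\epsilon_k)$$ form the factorized $L$-operator, and $$\tilde L(c|u)^{i'}_{j'}=\sum_{i,j=1}^n\bar\phi(u)_\lambda^{j',j}\,\phi(u)_{\lambda,i}^{i'}\,L(c|u)^i_j$$ is its conjugate by the matrix of intertwining vectors. Let $\Delta(\lambda)=\prod_{i<j}\theta(\lambda_{i,j})$. Assume $\theta(u)\ne0$. Let $U\subset\mathfrak h^*$ be an open set on which $\Delta$ has no zero and which carries a continuous branch of $\log\Delta$; use this branch to define $\Delta^{\pm c/n}$ on $U$. Then for all $i,j\in\{1,\dots,n\}$, acting on holomorphic functions on $U$, the derivative $\left.\frac{\partial}{\partial\hbar}\tilde L(c|u)^i_j\right|_{\hbar=0}$ of the operator composed with $\Delta^{c/n}$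 exists and $$\frac{\prod_{k\ne j}\theta(\lambda_{k,j})}{\prod_{k\ne i}\theta(\lambda_{k,i})}\cdot \Delta^{-c/n}\circ\left.\frac{\partial}{\partial\hbar}\tilde L(c|u)^i_j\right|_{\hbar=0}\circ\Delta^{c/n} =K(c|u)^i_j,$$ where $$K(c|u)^i_j=\delta^i_j\left\{\frac cn\frac{\theta'(u)}{\theta(u)}+\frac{\partial}{\partial\bar\epsilon_j}\right\} +(1-\delta^i_j)\,\frac cn\,\frac{\theta(u+\lambda_{j,i})\,\theta'(0)}{\theta(u)\,\theta(\lambda_{j,i})}.$$ Moreover $K(c|u)$ is Krichever's Lax matrix of the elliptic Calogero–Moser system up to a diagonal gauge transformation and the addition of a scalar matrix: let $\sigma(v)=e^{hv^2}\theta(v)/\theta'(0)$, $h=-2\pi i\frac{d}{d\tau}\log\eta(\tau)$, be the Weierstrass sigma function with periods $1,\tau$, let $\zeta=\sigma'/\sigma$ and $\Phi(s,u)=\frac{\sigma(u-s)}{\sigma(u)\sigma(s)}e^{\zeta(u)s}$. Then with $a=\theta'(u)/\theta(u)$, $$e^{a\langle\lambda,\bar\epsilon_i\rangle}\circ K(c|u)^i_j\circ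 e^{-a\langle\lambda,\bar\epsilon_j\rangle} =\left\{\delta^i_j\frac{\partial}{\partial\bar\epsilon_i}-(1-\delta^i_j)\frac cn\,\Phi(\lambda_{i,j},u)\right\} +\delta^i_j\Bigl(\frac cn-1+\frac1n\Bigr)a .$$ -/

import Mathlib

noncomputable section

namespace EllipticLax

open Complex

/-- `θ_{m,l}(u,τ) = ∑_{μ ∈ m + lℤ} exp 2πi(μ u + μ² τ / (2l))`. -/
def thetaChar (m l u τ : ℂ) : ℂ :=
  ∑' k : ℤ, exp (2 * Real.pi * I * ((m + l * k) * u + (m + l * k) ^ 2 / (2 * l) * τ))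

/-- The odd Jacobi theta function `θ(u) = θ_{1/2,1}(u + 1/2, τ)`. -/
def theta (τ u : ℂ) : ℂ := thetaChar (1 / 2) 1 (u + 1 / 2) τ

/-- `θ_j(u) = θ_{n/2-j,n}(u + 1/2, τ)` for `j = 1, …, n`; the index `j : Fin n` stands for the
integer `j + 1`. -/
def thetaVec (n : ℕ) (τ : ℂ) (j : Fin n) (u : ℂ) : ℂ :=
  thetaChar ((n : ℂ) / 2 - ((j : ℕ) + 1)) n (u + 1 / 2) τ

/-- The weight space `𝔥*` of `sl_n(ℂ)`: the orthogonal complement of `∑ᵢ εᵢ` in `ℂⁿ` for the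
bilinear form with `⟨εᵢ, εⱼ⟩ = δᵢⱼ`. -/
def WeightSpace (n : ℕ) : Submodule ℂ (Fin n → ℂ) where
  carrier := {x | x ⬝ᵥ 1 = 0}
  add_mem' := by
    intro a b ha hb
    simp only [Set.mem_ofPred_eq] at *
    rw [add_dotProduct, ha, hb, add_zero]
  zero_mem' := by simp
  smul_mem' := by
    intro t a ha
    simp only [Set.mem_ofPred_eq] at *
    rw [smul_dotProduct, ha, smul_zero]

/-- The orthogonal projection `ε̄ᵢ = εᵢ - (1/n) ∑ₖ εₖ` of `εᵢ` to the weight space. -/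
def epsBar {n : ℕ} (i : Fin n) : WeightSpace n :=
  ⟨Pi.single i 1 - (1 / (n : ℂ)) • 1, by
    have hn : (n : ℂ) ≠ 0 := by
      have := i.pos
      exact_mod_cast this.ne'
    change (Pi.single i 1 - (1 / (n : ℂ)) • (1 : Fin n → ℂ)) ⬝ᵥ 1 = 0
    rw [sub_dotProduct, smul_dotProduct]
    simp [hn]⟩

/-- The bilinear pairing `⟨x, y⟩` on the weight space. -/
def pairing {n : ℕ} (x y : WeightSpace n) : ℂ := (x : Fin n → ℂ) ⬝ᵥ (y : Fin n → ℂ)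

/-- `x_{i,j} = ⟨x, ε̄ᵢ - ε̄ⱼ⟩`. -/
def coordDiff {n : ℕ} (x : WeightSpace n) (i j : Fin n) : ℂ :=
  pairing x (epsBar i - epsBar j)

/-- Operators on functions on the weight space. -/
abbrev FunOp (n : ℕ) : Type := (WeightSpace n → ℂ) → (WeightSpace n → ℂ)

/-- The outgoing intertwining vectors: the `(j, k)` entry is the `j`-th component
`θ_j(u/n - ⟨x, ε̄ₖ⟩) / (√-1 η(τ))` of the vector attached to the arrow from `x` to `x + ħ ε̄ₖ`.
The arrow is recorded by its direction `k`; the value does not involve `ħ`. -/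
def outVec {n : ℕ} (τ u : ℂ) (x : WeightSpace n) : Matrix (Fin n) (Fin n) ℂ :=
  Matrix.of fun j k =>
    thetaVec n τ j (u / n - pairing x (epsBar k)) / (I * ModularForm.eta τ)

/-- The incoming intertwining vectors: the inverse of the matrix of outgoing ones. The `(k, j)` entry
is the `j`-th component of the vector attached to the arrow from `x` to `x + ħ ε̄ₖ`. -/
def inVec {n : ℕ} (τ u : ℂ) (x : WeightSpace n) : Matrix (Fin n) (Fin n) ℂ :=
  (outVec τ u x)⁻¹

/-- The factorized difference L-operator `L(c|u)^i_j`. -/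
def lOp {n : ℕ} (τ ħ c u : ℂ) (i j : Fin n) : FunOp n := fun f x =>
  ∑ k : Fin n, outVec τ (u + c * ħ) x j k * inVec τ u x k i * f (x + ħ • epsBar k)

/-- The conjugated L-operator `L̃(c|u)^{i'}_{j'}`. -/
def lTilde {n : ℕ} (τ ħ c u : ℂ) (i' j' : Fin n) : FunOp n := fun f x =>
  ∑ i : Fin n, ∑ j : Fin n, inVec τ u x j' j * outVec τ u x i i' * lOp τ ħ c u i j f x

/-- The `ħ`-derivative at `ħ = 0` of `L̃(c|u)^i_j`. -/
def lTildeDeriv {n : ℕ} (τ c u : ℂ) (i j : Fin n) : FunOp n := fun f x =>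
  deriv (fun ħ : ℂ => lTilde τ ħ c u i j f x) 0

/-- `Δ(x) = ∏_{i<j} θ(x_{i,j})`. -/
def thetaDelta {n : ℕ} (τ : ℂ) (x : WeightSpace n) : ℂ :=
  ∏ i : Fin n, ∏ j ∈ Finset.Ioi i, theta τ (coordDiff x i j)

/-- `∏_{k ≠ i} θ(x_{k,i})`. -/
def gaugeProd {n : ℕ} (τ : ℂ) (x : WeightSpace n) (i : Fin n) : ℂ :=
  ∏ k ∈ Finset.univ.erase i, theta τ (coordDiff x k i)

/-- `ℓ` is a (continuous, hence holomorphic) branch of `log Δ` on `U`. -/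
def IsLogDeltaBranch {n : ℕ} (τ : ℂ) (ℓ : WeightSpace n → ℂ) (U : Set (WeightSpace n)) : Prop :=
  ContinuousOn ℓ U ∧ ∀ x ∈ U, exp (ℓ x) = thetaDelta τ x

/-- Multiplication by the branch `Δ^s = exp (s ℓ)` of the power of `Δ`. -/
def mulDeltaPow {n : ℕ} (ℓ : WeightSpace n → ℂ) (s : ℂ) : FunOp n := fun f x =>
  exp (s * ℓ x) * f x

/-- The matrix of differential operators `K(c|u)^i_j`; `∂/∂ε̄ⱼ` is the derivative in the
direction `ε̄ⱼ`. -/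
def laxK {n : ℕ} (τ c u : ℂ) (i j : Fin n) : FunOp n := fun f x =>
  if i = j then
    c / n * (deriv (theta τ) u / theta τ u) * f x + lineDeriv ℂ f x (epsBar j)
  else
    c / n * (theta τ (u + coordDiff x j i) * deriv (theta τ) 0 /
      (theta τ u * theta τ (coordDiff x j i))) * f x

/-- The Weierstrass sigma function with periods `1, τ`, in its classical expression
`σ(u) = exp(h u²) θ(u) / θ'(0)`, `h = -2πi (d/dτ) log η(τ)`. -/
def wSigma (τ u : ℂ) : ℂ :=
  exp (-2 * Real.pi * I * logDeriv ModularForm.eta τ * u ^ 2) * theta τ u / deriv (theta τ) 0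

/-- The Lamé function `Φ(s, u) = σ(u - s) / (σ(u) σ(s)) · exp(ζ(u) s)`, where `ζ = σ'/σ`. -/
def lamePhi (τ s u : ℂ) : ℂ :=
  wSigma τ (u - s) / (wSigma τ u * wSigma τ s) * exp (logDeriv (wSigma τ) u * s)

/-- Krichever's Lax matrix of the elliptic Calogero–Moser system with coupling `g`, spectral
parameter `u` and momenta `∂/∂ε̄ᵢ`: the entries are `δᵢⱼ ∂/∂ε̄ᵢ + (1 - δᵢⱼ) g Φ(x_{i,j}, u)`. -/
def kricheverLax {n : ℕ} (τ g u : ℂ) (i j : Fin n) : FunOp n := fun f x =>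
  if i = j then lineDeriv ℂ f x (epsBar i) else g * lamePhi τ (coordDiff x i j) u * f x

/-- Multiplication by `exp (a ⟨x, ε̄ᵢ⟩)`. -/
def mulExp {n : ℕ} (a : ℂ) (i : Fin n) : FunOp n := fun f x =>
  exp (a * pairing x (epsBar i)) * f x

end EllipticLax

end

/-!
A product `∏ₖ θ(w - aₖ)` with `∑ₖ aₖ = 0` is a theta function of degree `n` with the same
multiplier as `θ_1, …, θ_n`, and comparing Fourier coefficients shows that it is a linear
combination of them. With `aₖ = u / n - ⟨λ, ε̄ₖ⟩`, except that one `aₖ` is diminished by `u`, this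
yields a left inverse of the matrix `φ(u)` of intertwining vectors, and moreover `φ̄(u) φ(v)` in
closed form for every `v`. It follows that `L̃(c|u)^i_j` is multiplication by the `(j, i)` entry of
`φ̄(u) φ(u + cħ)` composed with a single shift by `ħ ε̄ᵢ`. At `ħ = 0` this matrix is the identity;
its diagonal entries contribute logarithmic derivatives of `θ`, those at `λ_{k,i}` being cancelled
by the conjugation with `Δ^{c/n}`, and its off-diagonal entries have one vanishing factor
`θ(cħ/n)`. For the comparison with Krichever's matrix, `g(u - s) / (g(u) g(s)) exp((g'/g)(u) s)`
does not change when `g` is multiplied by a Gaussian `exp(h v²)`, so that `σ` may be replaced by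
`θ`.
-/

namespace EllipticLax

open Complex Finset

section Series

theorem hasSum_tsum_mul_sub {G R : Type*} [AddGroup G] [NormedRing R] [CompleteSpace R]
    {f g : G → R} {a b : R} (hf : HasSum f a) (hg : HasSum g b) (hf' : Summable fun k => ‖f k‖)
    (hg' : Summable fun k => ‖g k‖) : HasSum (fun m => ∑' k, f (m - k) * g k) (a * b) := by
  have hprod : HasSum (fun x : G × G => f x.1 * g x.2) (a * b) :=
    hf.mul hg (summable_mul_of_summable_norm hf' hg')
  let e : G × G ≃ G × G :=
    ((Equiv.prodComm G G).trans (Equiv.prodShear (Equiv.refl G) Equiv.subRight)).trans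
      (Equiv.prodComm G G)
  have hshear : HasSum (fun x : G × G => f (x.1 - x.2) * g x.2) (a * b) := e.hasSum_iff.mpr hprod
  exact hshear.prod_fiberwise fun m => (hshear.summable.prod_factor m).hasSum

theorem tsum_eq_sum_tsum_mul_add {E : Type*} [NormedAddCommGroup E] [CompleteSpace E] {f : ℤ → E}
    (hf : Summable f) (n : ℕ) [NeZero n] :
    ∑' m, f m = ∑ j : Fin n, ∑' k : ℤ, f (k * n + (j : ℕ)) := by
  let e : Fin n × ℤ ≃ ℤ := (Equiv.prodComm _ _).trans (Int.divModEquiv n).symm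
  exact (e.tsum_eq f).symm.trans ((e.summable_iff.mpr hf).tsum_prod.trans (tsum_fintype _))

end Series

section LogarithmicDerivative

theorem deriv_eq_logDeriv_of_eq_one {𝕜 𝕜' : Type*} [NontriviallyNormedField 𝕜]
    [NontriviallyNormedField 𝕜'] [NormedAlgebra 𝕜 𝕜'] {f : 𝕜 → 𝕜'} {t : 𝕜} (h : f t = 1) :
    deriv f t = logDeriv f t := by
  rw [logDeriv_apply, h, div_one]

variable {𝕜 : Type*} [NontriviallyNormedField 𝕜]

theorem odd_logDeriv {f : 𝕜 → 𝕜} (hf : Function.Odd f) : Function.Odd (logDeriv f) := by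
  intro t
  have hderiv : deriv f (-t) = deriv f t := by
    have h := deriv_comp_neg f t
    simp only [hf.eq, deriv.fun_neg] at h
    exact (neg_injective h).symm
  rw [logDeriv_apply, logDeriv_apply, hderiv, hf, div_neg]

theorem logDeriv_prod_comp_add_mul {ι : Type*} {f : 𝕜 → 𝕜} (hf : Differentiable 𝕜 f)
    (s : Finset ι) (a b : ι → 𝕜) (h0 : ∀ k ∈ s, f (a k) ≠ 0) :
    logDeriv (fun t => ∏ k ∈ s, f (a k + t * b k)) 0 = ∑ k ∈ s, b k * logDeriv f (a k) := by
  have hfactor (k : ι) : logDeriv (fun t => f (a k + t * b k)) 0 = b k * logDeriv f (a k) := by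
    have hline : HasDerivAt (fun t => a k + t * b k) (b k) 0 :=
      (hasDerivAt_mul_const (b k)).const_add (a k)
    have h := logDeriv_comp (f := f) (g := fun t => a k + t * b k) (x := 0) (hf _)
      hline.differentiableAt
    rw [hline.deriv, zero_mul, add_zero] at h
    rw [← mul_comm (logDeriv f (a k)), ← h]
    rfl
  rw [logDeriv_prod (by simpa using h0) fun k _ => by fun_prop]
  exact sum_congr rfl fun k _ => hfactor k

theorem hasDerivAt_of_comp [CompleteSpace 𝕜] {φ g : 𝕜 → 𝕜} {φ' h' t : 𝕜} (hg : ContinuousAt g t)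
    (hφ : HasStrictDerivAt φ φ' (g t)) (hφ' : φ' ≠ 0) (h : HasDerivAt (φ ∘ g) h' t) :
    HasDerivAt g (φ'⁻¹ * h') t := by
  have hψ := (hφ.to_localInverse hφ').hasDerivAt.comp t h
  refine hψ.congr_of_eventuallyEq ?_
  have hleft := (hφ.hasStrictFDerivAt_equiv hφ').eventually_left_inverse
  filter_upwards [hg.eventually hleft] with y hy using hy.symm

theorem hasDerivAt_of_cexp_eventuallyEq {g h : ℂ → ℂ} {t : ℂ} (hg : ContinuousAt g t)
    (hh : DifferentiableAt ℂ h t) (heq : (fun y => exp (g y)) =ᶠ[nhds t] h) :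
    HasDerivAt g (logDeriv h t) t := by
  have hcomp := hasDerivAt_of_comp hg (hasStrictDerivAt_exp (g t)) (exp_ne_zero _)
    (hh.hasDerivAt.congr_of_eventuallyEq heq)
  refine hcomp.congr_deriv ?_
  rw [logDeriv_apply, ← heq.self_of_nhds, div_eq_inv_mul]

theorem hasLineDerivAt_cexp_mul {E : Type*} [AddCommGroup E] [Module ℂ E] {g f : E → ℂ}
    {g' f' : ℂ} {x v : E} (hg : HasLineDerivAt ℂ g g' x v) (hf : HasLineDerivAt ℂ f f' x v) :
    HasLineDerivAt ℂ (fun y => exp (g y) * f y) (exp (g x) * (f' + g' * f x)) x v := by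
  have h : HasDerivAt (fun t : ℂ => exp (g (x + t • v)) * f (x + t • v)) _ 0 :=
    (HasDerivAt.cexp hg).mul hf
  refine h.congr_deriv ?_
  simp only [zero_smul, add_zero]
  ring

end LogarithmicDerivative

section ThetaExpansion

/-- `f` is a theta function of degree `p` with `f (w + 1) = (-1) ^ p f w` and multiplier
`exp (-2πi (b + p (w + τ / 2)))` under `w ↦ w + τ`. This is encoded by a Fourier expansion over
`p / 2 + ℤ`, with the frequency `m + p / 2` indexed by `m : ℤ`, in which the quasi-periodicity in
the direction `τ` becomes a recurrence for the coefficients. -/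
def HasThetaExpansion (τ : ℂ) (p : ℕ) (b : ℂ) (f : ℂ → ℂ) : Prop :=
  ∃ c : ℤ → ℂ, (∀ w, HasSum (fun m : ℤ => c m * exp (2 * Real.pi * I * ((m + p / 2) * w))) (f w)) ∧
    ∀ m : ℤ, c (m + p) = c m * exp (2 * Real.pi * I * (b + (m + p / 2) * τ + p / 2 * τ))

variable {τ : ℂ}

theorem hasThetaExpansion_one (τ : ℂ) : HasThetaExpansion τ 0 0 (fun _ => 1) := by
  refine ⟨Pi.single 0 1, fun w => ?_, fun m => ?_⟩
  · convert hasSum_ite_eq (0 : ℤ) (1 : ℂ) using 2 with m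
    by_cases h : m = 0 <;> simp [h]
  · by_cases h : m = 0 <;> simp [h]

theorem HasThetaExpansion.mul {p q : ℕ} {a b : ℂ} {f g : ℂ → ℂ}
    (hf : HasThetaExpansion τ p a f) (hg : HasThetaExpansion τ q b g) :
    HasThetaExpansion τ (p + q) (a + b) (fun w => f w * g w) := by
  obtain ⟨c, hc, hcr⟩ := hf
  obtain ⟨d, hd, hdr⟩ := hg
  refine ⟨fun m => ∑' k, c (m - k) * d k, fun w => ?_, fun m => ?_⟩
  · refine (hasSum_tsum_mul_sub (hc w) (hd w) (hc w).summable.norm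
      (hd w).summable.norm).congr_fun fun m => ?_
    rw [← tsum_mul_right]
    refine tsum_congr fun k => ?_
    rw [mul_mul_mul_comm (c _), ← exp_add]
    congr 2
    push_cast
    ring
  · rw [← tsum_mul_right]
    refine ((Equiv.addRight (q : ℤ)).tsum_eq _).symm.trans (tsum_congr fun k => ?_)
    have hindex : m + ((p + q : ℕ) : ℤ) - (k + q) = m - k + p := by push_cast; ring
    simp only [Equiv.coe_addRight]
    rw [hindex, hcr, hdr, mul_mul_mul_comm, ← exp_add]
    congr 2
    push_cast
    ring

theorem HasThetaExpansion.prod {ι : Type*} {p : ι → ℕ} {b : ι → ℂ} {f : ι → ℂ → ℂ}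
    (s : Finset ι) (h : ∀ k ∈ s, HasThetaExpansion τ (p k) (b k) (f k)) :
    HasThetaExpansion τ (∑ k ∈ s, p k) (∑ k ∈ s, b k) (fun w => ∏ k ∈ s, f k w) := by
  induction s using Finset.cons_induction with
  | empty => simpa using hasThetaExpansion_one τ
  | cons k s hk ih =>
    rw [forall_mem_cons] at h
    simp only [sum_cons, prod_cons]
    exact h.1.mul (ih h.2)

/-- The coefficient at the frequency `m + n / 2` in the Fourier expansion of the one among
`θ_1, …, θ_n` whose expansion contains this frequency, namely `θ_j` with `j ≡ -m` modulo `n`. -/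
noncomputable def thetaCoeff (τ : ℂ) (n : ℕ) (m : ℤ) : ℂ :=
  exp (2 * Real.pi * I * ((m + n / 2) * (1 / 2) + (m + n / 2) ^ 2 / (2 * n) * τ))

theorem thetaCoeff_ne_zero (τ : ℂ) (n : ℕ) (m : ℤ) : thetaCoeff τ n m ≠ 0 :=
  exp_ne_zero _

theorem thetaVec_eq_tsum_thetaCoeff (n : ℕ) (τ : ℂ) (j : Fin n) (w : ℂ) :
    thetaVec n τ j w = ∑' k : ℤ, thetaCoeff τ n (-1 - (k * n + (j : ℕ))) *
      exp (2 * Real.pi * I * (((-1 - (k * n + (j : ℕ)) : ℤ) + n / 2) * w)) := by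
  rw [thetaVec, thetaChar, ← (Equiv.neg ℤ).tsum_eq]
  refine tsum_congr fun k => ?_
  rw [thetaCoeff, ← exp_add, Equiv.neg_apply]
  congr 1
  push_cast
  ring

theorem thetaCoeff_add (τ : ℂ) (n : ℕ) [NeZero n] (m : ℤ) :
    thetaCoeff τ n (m + n) =
      thetaCoeff τ n m * exp (2 * Real.pi * I * (n / 2 + (m + n / 2) * τ + n / 2 * τ)) := by
  have hn : (n : ℂ) ≠ 0 := NeZero.ne _
  rw [thetaCoeff, thetaCoeff, ← exp_add]
  congr 1
  push_cast
  field_simp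
  ring

theorem HasThetaExpansion.exists_eq_sum_thetaVec {n : ℕ} [NeZero n] {f : ℂ → ℂ}
    (h : HasThetaExpansion τ n (n / 2) f) :
    ∃ b : Fin n → ℂ, ∀ w, f w = ∑ j, b j * thetaVec n τ j w := by
  obtain ⟨c, hc, hcr⟩ := h
  have hperiodic : Function.Periodic (fun m => c m / thetaCoeff τ n m) (n : ℤ) := fun m => by
    simp only [hcr, thetaCoeff_add, mul_div_mul_right _ _ (exp_ne_zero _)]
  have hcoeff (k : ℤ) (j : Fin n) : c (-1 - (k * n + (j : ℕ))) =
      c (-1 - (j : ℕ)) / thetaCoeff τ n (-1 - (j : ℕ)) *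
        thetaCoeff τ n (-1 - (k * n + (j : ℕ))) := by
    have hk := hperiodic.sub_int_mul_eq (x := -1 - ((j : ℕ) : ℤ)) k
    rw [← hk, sub_sub, add_comm ((j : ℕ) : ℤ), Int.cast_id,
      div_mul_cancel₀ _ (thetaCoeff_ne_zero _ _ _)]
  refine ⟨fun j => c (-1 - (j : ℕ)) / thetaCoeff τ n (-1 - (j : ℕ)), fun w => ?_⟩
  have hreflect := (Equiv.subLeft (-1 : ℤ)).hasSum_iff.mpr (hc w)
  rw [← hreflect.tsum_eq, tsum_eq_sum_tsum_mul_add hreflect.summable n]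
  refine sum_congr rfl fun j _ => ?_
  rw [thetaVec_eq_tsum_thetaCoeff, ← tsum_mul_left]
  refine tsum_congr fun k => ?_
  rw [Function.comp_apply, Equiv.subLeft_apply, hcoeff, mul_assoc]

end ThetaExpansion

section Theta

variable {τ : ℂ}

theorem thetaChar_eq_mul_jacobiTheta₂ {l : ℂ} (hl : l ≠ 0) (m u τ : ℂ) :
    thetaChar m l u τ = exp (2 * Real.pi * I * (m * u + m ^ 2 / (2 * l) * τ)) *
      jacobiTheta₂ (l * u + m * τ) (l * τ) := by
  rw [thetaChar, jacobiTheta₂, ← tsum_mul_left]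
  refine tsum_congr fun k => ?_
  rw [jacobiTheta₂_term, ← exp_add]
  congr 1
  field_simp
  ring

theorem differentiable_thetaChar {l : ℂ} (hlτ : 0 < (l * τ).im) (m : ℂ) :
    Differentiable ℂ fun u => thetaChar m l u τ := by
  have hl : l ≠ 0 := by rintro rfl; simp at hlτ
  have hJ : Differentiable ℂ fun z => jacobiTheta₂ z (l * τ) := fun z =>
    differentiableAt_jacobiTheta₂_fst z hlτ
  simp only [thetaChar_eq_mul_jacobiTheta₂ hl]
  fun_prop

theorem hasSum_thetaChar {l : ℂ} (hlτ : 0 < (l * τ).im) (m u : ℂ) :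
    HasSum (fun k : ℤ => exp (2 * Real.pi * I * ((m + l * k) * u + (m + l * k) ^ 2 / (2 * l) * τ)))
      (thetaChar m l u τ) := by
  have hl : l ≠ 0 := by rintro rfl; simp at hlτ
  rw [thetaChar_eq_mul_jacobiTheta₂ hl]
  refine ((hasSum_jacobiTheta₂_term (l * u + m * τ) hlτ).mul_left _).congr_fun fun k => ?_
  rw [jacobiTheta₂_term, ← exp_add]
  congr 1
  field_simp
  ring

theorem differentiable_theta (hτ : 0 < τ.im) : Differentiable ℂ (theta τ) :=
  (differentiable_thetaChar (by rwa [one_mul]) _).comp (differentiable_id.add_const _)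

theorem odd_theta (τ : ℂ) : Function.Odd (theta τ) := by
  intro u
  simp only [theta, thetaChar]
  rw [← tsum_neg, ← (Equiv.subLeft (-1 : ℤ)).tsum_eq]
  refine tsum_congr fun k => ?_
  rw [← neg_one_mul (exp _), ← exp_pi_mul_I, ← exp_add, exp_eq_exp_iff_exists_int]
  refine ⟨-k - 1, ?_⟩
  simp only [Equiv.subLeft_apply]
  push_cast
  ring

theorem hasThetaExpansion_theta_sub (hτ : 0 < τ.im) (a : ℂ) :
    HasThetaExpansion τ 1 (1 / 2 - a) (fun w => theta τ (w - a)) := by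
  refine ⟨fun m => exp (2 * Real.pi * I *
    ((m + 1 / 2) * (1 / 2 - a) + (m + 1 / 2) ^ 2 / 2 * τ)), fun w => ?_, fun m => ?_⟩
  · refine (hasSum_thetaChar (l := 1) (by rwa [one_mul]) (1 / 2) (w - a + 1 / 2)).congr_fun
      fun m => ?_
    rw [← exp_add]
    congr 1
    push_cast
    ring
  · simp only [← exp_add]
    congr 1
    push_cast
    ring

theorem exists_prod_theta_sub_eq_sum_thetaVec {n : ℕ} [NeZero n] (hτ : 0 < τ.im) {a : Fin n → ℂ}
    (ha : ∑ k, a k = 0) :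
    ∃ b : Fin n → ℂ, ∀ w, ∏ k, theta τ (w - a k) = ∑ l, b l * thetaVec n τ l w := by
  have h := HasThetaExpansion.prod univ fun k _ => hasThetaExpansion_theta_sub hτ (a k)
  have hb : ∑ k, (1 / 2 - a k) = (n : ℂ) / 2 := by
    rw [sum_sub_distrib, ha]
    simp [div_eq_mul_inv]
  rw [hb, sum_const, card_univ, Fintype.card_fin, smul_eq_mul, mul_one] at h
  exact h.exists_eq_sum_thetaVec

end Theta

section WeightSpace

variable {n : ℕ}

theorem pairing_epsBar (x : WeightSpace n) (i : Fin n) :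
    pairing x (epsBar i) = (x : Fin n → ℂ) i := by
  have hx : (x : Fin n → ℂ) ⬝ᵥ 1 = 0 := x.2
  simp [pairing, epsBar, dotProduct_sub, dotProduct_smul, hx]

theorem sum_pairing_epsBar (x : WeightSpace n) : ∑ i, pairing x (epsBar i) = 0 := by
  have hx : (x : Fin n → ℂ) ⬝ᵥ 1 = 0 := x.2
  simpa [pairing_epsBar, dotProduct] using hx

theorem pairing_epsBar_epsBar (i j : Fin n) :
    pairing (epsBar i) (epsBar j) = (if i = j then 1 else 0) - 1 / (n : ℂ) := by
  rw [pairing_epsBar]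
  simp [epsBar, Pi.single_apply, eq_comm]

theorem pairing_add_smul (x y z : WeightSpace n) (t : ℂ) :
    pairing (x + t • y) z = pairing x z + t * pairing y z := by
  simp [pairing, add_dotProduct, smul_dotProduct]

theorem coordDiff_eq (x : WeightSpace n) (i j : Fin n) :
    coordDiff x i j = pairing x (epsBar i) - pairing x (epsBar j) := by
  simp only [coordDiff, pairing]
  exact dotProduct_sub _ _ _

theorem coordDiff_self (x : WeightSpace n) (i : Fin n) : coordDiff x i i = 0 := by
  rw [coordDiff_eq, sub_self]

theorem neg_coordDiff (x : WeightSpace n) (i j : Fin n) : -coordDiff x i j = coordDiff x j i := by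
  rw [coordDiff_eq, coordDiff_eq, neg_sub]

theorem coordDiff_add_smul_epsBar (x : WeightSpace n) (t : ℂ) (i k l : Fin n) :
    coordDiff (x + t • epsBar i) k l =
      coordDiff x k l + t * ((if i = k then 1 else 0) - if i = l then 1 else 0) := by
  simp only [coordDiff_eq, pairing_add_smul, pairing_epsBar_epsBar]
  ring

end WeightSpace

section ThetaDelta

variable {n : ℕ} {τ : ℂ} {x : WeightSpace n}

theorem theta_coordDiff_ne_zero (h : thetaDelta τ x ≠ 0) {i j : Fin n} (hij : i ≠ j) :
    theta τ (coordDiff x i j) ≠ 0 := by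
  have hlt (k l : Fin n) (hkl : k < l) : theta τ (coordDiff x k l) ≠ 0 :=
    prod_ne_zero_iff.mp (prod_ne_zero_iff.mp h k (mem_univ k)) l (mem_Ioi.mpr hkl)
  rcases lt_or_gt_of_ne hij with hij | hji
  · exact hlt i j hij
  · rw [← neg_coordDiff, odd_theta]
    exact neg_ne_zero.mpr (hlt j i hji)

theorem gaugeProd_ne_zero (h : thetaDelta τ x ≠ 0) (i : Fin n) : gaugeProd τ x i ≠ 0 :=
  prod_ne_zero_iff.mpr fun _ hk => theta_coordDiff_ne_zero h (ne_of_mem_erase hk)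

theorem gaugeProd_eq_mul_prod (τ : ℂ) (x : WeightSpace n) {i j : Fin n} (hij : i ≠ j) :
    gaugeProd τ x i =
      theta τ (coordDiff x j i) * ∏ k ∈ (univ.erase j).erase i, theta τ (coordDiff x k i) := by
  rw [gaugeProd, erase_right_comm]
  exact (mul_prod_erase _ (fun k => theta τ (coordDiff x k i))
    (mem_erase.mpr ⟨hij.symm, mem_univ j⟩)).symm

theorem sum_sum_Ioi_ite_sub_ite_mul {ι R : Type*} [Fintype ι] [LinearOrder ι]
    [LocallyFiniteOrderTop ι] [Ring R] {G : ι → ι → R} (hG : ∀ k l, G k l = -G l k) (i : ι) :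
    ∑ k, ∑ l ∈ Ioi k, ((if i = k then 1 else 0) - if i = l then 1 else 0) * G k l =
      -∑ k ∈ univ.erase i, G k i := by
  have hsplit (k : ι) :
      ∑ l ∈ Ioi k, ((if i = k then 1 else 0) - if i = l then 1 else 0) * G k l =
        (if i = k then ∑ l ∈ Ioi i, G i l else 0) - if k < i then G k i else 0 := by
    by_cases hik : i = k
    · subst hik
      simp [sub_mul]
    · simp [hik]
  have herase : univ.erase i = Ioi i ∪ univ.filter (· < i) := by
    ext k
    simp only [mem_erase, mem_univ, mem_union, mem_Ioi, mem_filter, and_true, true_and]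
    rw [ne_iff_lt_or_gt, or_comm]
  have hdisj : Disjoint (Ioi i) (univ.filter (· < i)) :=
    disjoint_left.mpr fun k hk hk' => lt_asymm (mem_Ioi.mp hk) (mem_filter.mp hk').2
  simp only [hsplit, sum_sub_distrib, sum_ite_eq, mem_univ, if_true]
  rw [herase, sum_union hdisj, neg_add, ← sum_neg_distrib, sum_filter, sub_eq_add_neg]
  simp only [← hG]

theorem thetaDelta_add_smul_epsBar (τ : ℂ) (x : WeightSpace n) (i : Fin n) (t : ℂ) :
    thetaDelta τ (x + t • epsBar i) = ∏ p ∈ univ.sigma fun k : Fin n => Ioi k,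
      theta τ (coordDiff x p.1 p.2 +
        t * ((if i = p.1 then 1 else 0) - if i = p.2 then 1 else 0)) := by
  simp only [thetaDelta, prod_sigma, coordDiff_add_smul_epsBar]

theorem logDeriv_thetaDelta_add_smul_epsBar (hτ : 0 < τ.im) (h : thetaDelta τ x ≠ 0) (i : Fin n) :
    logDeriv (fun t : ℂ => thetaDelta τ (x + t • epsBar i)) 0 =
      -∑ k ∈ univ.erase i, logDeriv (theta τ) (coordDiff x k i) := by
  simp only [thetaDelta_add_smul_epsBar]
  rw [logDeriv_prod_comp_add_mul (differentiable_theta hτ), sum_sigma]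
  · refine sum_sum_Ioi_ite_sub_ite_mul
      (G := fun k l => logDeriv (theta τ) (coordDiff x k l)) (fun k l => ?_) i
    rw [← odd_logDeriv (odd_theta τ), neg_coordDiff]
  · intro p hp
    exact theta_coordDiff_ne_zero h (mem_Ioi.mp (mem_sigma.mp hp).2).ne

variable {U : Set (WeightSpace n)} {ℓ : WeightSpace n → ℂ}

theorem IsLogDeltaBranch.thetaDelta_ne_zero (hℓ : IsLogDeltaBranch τ ℓ U) (hx : x ∈ U) :
    thetaDelta τ x ≠ 0 :=
  hℓ.2 x hx ▸ exp_ne_zero _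

theorem IsLogDeltaBranch.hasLineDerivAt_epsBar (hℓ : IsLogDeltaBranch τ ℓ U) (hτ : 0 < τ.im)
    (hU : U ∈ nhds x) (i : Fin n) :
    HasLineDerivAt ℂ ℓ (-∑ k ∈ univ.erase i, logDeriv (theta τ) (coordDiff x k i)) x
      (epsBar i) := by
  have hΔ : thetaDelta τ x ≠ 0 := hℓ.thetaDelta_ne_zero (mem_of_mem_nhds hU)
  have hline : Filter.Tendsto (fun t : ℂ => x + t • epsBar i) (nhds 0) (nhds x) := by
    have : Continuous fun t : ℂ => x + t • epsBar i := by fun_prop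
    simpa using this.tendsto 0
  rw [← logDeriv_thetaDelta_add_smul_epsBar hτ hΔ]
  refine hasDerivAt_of_cexp_eventuallyEq ?_ ?_ ((hline.eventually hU).mono fun t ht => hℓ.2 _ ht)
  · simpa [ContinuousAt, Function.comp_def] using (hℓ.1.continuousAt hU).tendsto.comp hline
  · have := differentiable_theta hτ
    simp only [thetaDelta_add_smul_epsBar]
    fun_prop

theorem IsLogDeltaBranch.hasLineDerivAt_mulDeltaPow (hℓ : IsLogDeltaBranch τ ℓ U) (hτ : 0 < τ.im)
    (hU : U ∈ nhds x) (s : ℂ) {f : WeightSpace n → ℂ} {f' : ℂ} {i : Fin n}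
    (hf : HasLineDerivAt ℂ f f' x (epsBar i)) :
    HasLineDerivAt ℂ (mulDeltaPow ℓ s f) (exp (s * ℓ x) * (f' -
      s * (∑ k ∈ univ.erase i, logDeriv (theta τ) (coordDiff x k i)) * f x)) x (epsBar i) := by
  rw [sub_eq_add_neg, ← neg_mul, ← mul_neg]
  exact hasLineDerivAt_cexp_mul ((hℓ.hasLineDerivAt_epsBar hτ hU i).const_mul s) hf

end ThetaDelta

section LOperator

variable {n : ℕ} {τ u : ℂ} {x : WeightSpace n}

/-- The matrix which carries the outgoing intertwining vectors with spectral parameter `u` to those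
with spectral parameter `u + n s`, that is, the product `φ̄(u)_λ φ(u + n s)_λ`, in closed form. -/
noncomputable def exchangeMatrix (τ u s : ℂ) (x : WeightSpace n) : Matrix (Fin n) (Fin n) ℂ :=
  Matrix.of fun j i => theta τ (u + s + coordDiff x j i) *
    (∏ k ∈ univ.erase j, theta τ (coordDiff x k i + s)) / (theta τ u * gaugeProd τ x j)

theorem exchangeMatrix_apply (τ u s : ℂ) (x : WeightSpace n) (j i : Fin n) :
    exchangeMatrix τ u s x j i = theta τ (u + s + coordDiff x j i) *
      (∏ k ∈ univ.erase j, theta τ (coordDiff x k i + s)) / (theta τ u * gaugeProd τ x j) :=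
  rfl

theorem exchangeMatrix_zero (hu : theta τ u ≠ 0) (hx : thetaDelta τ x ≠ 0) :
    exchangeMatrix τ u 0 x = 1 := by
  ext j i
  simp only [exchangeMatrix_apply, add_zero]
  by_cases hji : j = i
  · subst hji
    rw [coordDiff_self, add_zero, Matrix.one_apply_eq]
    exact div_self (mul_ne_zero hu (gaugeProd_ne_zero hx j))
  · have hi : theta τ (coordDiff x i i) = 0 := by rw [coordDiff_self, (odd_theta τ).map_zero]
    rw [Matrix.one_apply_ne hji,
      prod_eq_zero (mem_erase.mpr ⟨Ne.symm hji, mem_univ i⟩) hi, mul_zero, zero_div]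

theorem exists_sum_thetaVec_eq_theta_mul_prod (hτ : 0 < τ.im) (u : ℂ) (x : WeightSpace n)
    (j : Fin n) : ∃ b : Fin n → ℂ, ∀ v i,
      ∑ l, b l * thetaVec n τ l (v / n - pairing x (epsBar i)) =
        theta τ (u + (v - u) / n + coordDiff x j i) *
          ∏ k ∈ univ.erase j, theta τ (coordDiff x k i + (v - u) / n) := by
  have : NeZero n := ⟨j.pos.ne'⟩
  let a : Fin n → ℂ := fun k => u / n - pairing x (epsBar k) - (Pi.single j u : Fin n → ℂ) k
  have ha : ∑ k, a k = 0 := by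
    have hn : (n : ℂ) ≠ 0 := NeZero.ne _
    simp [a, sum_sub_distrib, sum_pairing_epsBar, mul_div_cancel₀ _ hn]
  obtain ⟨b, hb⟩ := exists_prod_theta_sub_eq_sum_thetaVec hτ ha
  refine ⟨b, fun v i => ?_⟩
  rw [← hb, ← mul_prod_erase _ _ (mem_univ j)]
  congr 1
  · simp only [a, Pi.single_eq_same, coordDiff_eq]
    congr 1
    ring
  · refine prod_congr rfl fun k hk => ?_
    simp only [a, Pi.single_eq_of_ne (ne_of_mem_erase hk), coordDiff_eq]
    congr 1
    ring

theorem exists_mul_outVec_eq_exchangeMatrix (hτ : 0 < τ.im) (u : ℂ) (x : WeightSpace n) :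
    ∃ B : Matrix (Fin n) (Fin n) ℂ, ∀ v, B * outVec τ v x = exchangeMatrix τ u ((v - u) / n) x := by
  have hη : ModularForm.eta τ ≠ 0 := ModularForm.eta_ne_zero hτ
  choose b hb using exists_sum_thetaVec_eq_theta_mul_prod hτ u x
  refine ⟨Matrix.of fun j l => b j l * (I * ModularForm.eta τ) / (theta τ u * gaugeProd τ x j),
    fun v => ?_⟩
  ext j i
  rw [exchangeMatrix_apply, ← hb, Matrix.mul_apply, sum_div]
  refine sum_congr rfl fun l _ => ?_
  simp only [Matrix.of_apply, outVec]
  field_simp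

theorem inVec_mul_outVec (hτ : 0 < τ.im) (hu : theta τ u ≠ 0) (hx : thetaDelta τ x ≠ 0) (v : ℂ) :
    inVec τ u x * outVec τ v x = exchangeMatrix τ u ((v - u) / n) x := by
  obtain ⟨B, hB⟩ := exists_mul_outVec_eq_exchangeMatrix hτ u x
  have hinv : B * outVec τ u x = 1 := by rw [hB, sub_self, zero_div, exchangeMatrix_zero hu hx]
  rw [inVec, Matrix.inv_eq_left_inv hinv, hB]

theorem lTilde_eq_mul_diagonal_mul (τ ħ c u : ℂ) (i j : Fin n) (f : WeightSpace n → ℂ)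
    (x : WeightSpace n) :
    lTilde τ ħ c u i j f x = (inVec τ u x * outVec τ (u + c * ħ) x *
      Matrix.diagonal (fun k => f (x + ħ • epsBar k)) * (inVec τ u x * outVec τ u x) :
        Matrix (Fin n) (Fin n) ℂ) j i := by
  have hL (a b : Fin n) : lOp τ ħ c u a b f x = (outVec τ (u + c * ħ) x *
      Matrix.diagonal (fun k => f (x + ħ • epsBar k)) * inVec τ u x :
        Matrix (Fin n) (Fin n) ℂ) b a := by
    simp only [lOp, Matrix.mul_apply (N := inVec τ u x), Matrix.mul_diagonal, mul_right_comm]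
  simp only [lTilde, hL]
  rw [← Matrix.mul_assoc, Matrix.mul_assoc (inVec τ u x), Matrix.mul_assoc (inVec τ u x),
    Matrix.mul_apply]
  simp only [Matrix.mul_apply (M := inVec τ u x), sum_mul, mul_right_comm]

theorem lTilde_eq_exchangeMatrix_mul (hτ : 0 < τ.im) (hu : theta τ u ≠ 0)
    (hx : thetaDelta τ x ≠ 0) (ħ c : ℂ) (i j : Fin n) (f : WeightSpace n → ℂ) :
    lTilde τ ħ c u i j f x = exchangeMatrix τ u (c / n * ħ) x j i * f (x + ħ • epsBar i) := by
  have hs : (u + c * ħ - u) / n = c / n * ħ := by ring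
  rw [lTilde_eq_mul_diagonal_mul, inVec_mul_outVec hτ hu hx, inVec_mul_outVec hτ hu hx, sub_self,
    zero_div, exchangeMatrix_zero hu hx, Matrix.mul_one, Matrix.mul_diagonal, hs]

theorem differentiable_exchangeMatrix (hτ : 0 < τ.im) (u : ℂ) (x : WeightSpace n) (j i : Fin n) :
    Differentiable ℂ fun s => exchangeMatrix τ u s x j i := by
  have := differentiable_theta hτ
  simp only [exchangeMatrix_apply, div_eq_mul_inv]
  fun_prop

theorem deriv_exchangeMatrix_diag (hτ : 0 < τ.im) (hu : theta τ u ≠ 0) (hx : thetaDelta τ x ≠ 0)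
    (i : Fin n) :
    deriv (fun s => exchangeMatrix τ u s x i i) 0 = logDeriv (theta τ) u +
      ∑ k ∈ univ.erase i, logDeriv (theta τ) (coordDiff x k i) := by
  have hθ := differentiable_theta hτ
  have hg := gaugeProd_ne_zero hx i
  have hone : exchangeMatrix τ u 0 x i i = 1 := by
    rw [exchangeMatrix_zero hu hx, Matrix.one_apply_eq]
  have hfactor : logDeriv (fun s => theta τ (u + s)) 0 = logDeriv (theta τ) u := by
    rw [logDeriv_apply, logDeriv_apply, deriv_comp_const_add, add_zero]
  have hprod := logDeriv_prod_comp_add_mul hθ (univ.erase i) (fun k => coordDiff x k i) 1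
    fun k hk => theta_coordDiff_ne_zero hx (ne_of_mem_erase hk)
  simp only [Pi.one_apply, mul_one, one_mul] at hprod
  rw [deriv_eq_logDeriv_of_eq_one (f := fun s => exchangeMatrix τ u s x i i) hone]
  simp only [exchangeMatrix_apply, coordDiff_self, add_zero, div_eq_mul_inv]
  rw [logDeriv_mul_const _ _ (inv_ne_zero (mul_ne_zero hu hg)), logDeriv_mul, hfactor, hprod]
  · rwa [add_zero]
  · simpa only [add_zero, gaugeProd] using hg
  · fun_prop
  · fun_prop

theorem deriv_exchangeMatrix_offDiag (hτ : 0 < τ.im) (u : ℂ) (hx : thetaDelta τ x ≠ 0)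
    {i j : Fin n} (hij : i ≠ j) :
    deriv (fun s => exchangeMatrix τ u s x j i) 0 =
      gaugeProd τ x i / gaugeProd τ x j * (theta τ (u + coordDiff x j i) * deriv (theta τ) 0 /
        (theta τ u * theta τ (coordDiff x j i))) := by
  have hθ := differentiable_theta hτ
  let R : ℂ → ℂ := fun s => theta τ (u + s + coordDiff x j i) *
    (∏ k ∈ (univ.erase j).erase i, theta τ (coordDiff x k i + s)) / (theta τ u * gaugeProd τ x j)
  have hfactor (s : ℂ) : exchangeMatrix τ u s x j i = theta τ s * R s := by
    rw [exchangeMatrix_apply, ← mul_prod_erase _ _ (mem_erase.mpr ⟨hij, mem_univ i⟩),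
      coordDiff_self, zero_add]
    ring
  have hR : DifferentiableAt ℂ R 0 := by
    simp only [R, div_eq_mul_inv]
    fun_prop
  have hji := theta_coordDiff_ne_zero hx hij.symm
  simp only [hfactor]
  rw [deriv_fun_mul (hθ 0) hR, (odd_theta τ).map_zero, zero_mul, add_zero,
    gaugeProd_eq_mul_prod τ x hij]
  simp only [R, add_zero]
  field_simp

theorem hasDerivAt_lTilde (hτ : 0 < τ.im) (hu : theta τ u ≠ 0) (hx : thetaDelta τ x ≠ 0) (c : ℂ)
    {i : Fin n} (j : Fin n) {F : WeightSpace n → ℂ} {F' : ℂ}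
    (hF : HasLineDerivAt ℂ F F' x (epsBar i)) :
    HasDerivAt (fun ħ => lTilde τ ħ c u i j F x)
      (c / n * deriv (fun s => exchangeMatrix τ u s x j i) 0 * F x +
        (1 : Matrix (Fin n) (Fin n) ℂ) j i * F') 0 := by
  have hM : HasDerivAt (fun ħ => exchangeMatrix τ u (c / n * ħ) x j i)
      (c / n * deriv (fun s => exchangeMatrix τ u s x j i) 0) 0 := by
    have h := (differentiable_exchangeMatrix hτ u x j i (c / n * 0)).hasDerivAt.comp 0
      (hasDerivAt_const_mul (c / n))
    rwa [mul_zero, mul_comm] at h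
  simp only [lTilde_eq_exchangeMatrix_mul hτ hu hx]
  refine HasDerivAt.congr_deriv (hM.mul hF) ?_
  simp only [mul_zero, zero_smul, add_zero, exchangeMatrix_zero hu hx]

theorem gaugeProd_div_mul_mulDeltaPow_lTildeDeriv (hτ : 0 < τ.im) (c : ℂ) (hu : theta τ u ≠ 0)
    {U : Set (WeightSpace n)} (hU : U ∈ nhds x) {ℓ : WeightSpace n → ℂ}
    (hℓ : IsLogDeltaBranch τ ℓ U) {f : WeightSpace n → ℂ} {i : Fin n}
    (hf : LineDifferentiableAt ℂ f x (epsBar i)) (j : Fin n) :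
    gaugeProd τ x j / gaugeProd τ x i * mulDeltaPow ℓ (-(c / n))
      (lTildeDeriv τ c u i j (mulDeltaPow ℓ (c / n) f)) x = laxK τ c u i j f x := by
  have hΔ : thetaDelta τ x ≠ 0 := hℓ.thetaDelta_ne_zero (mem_of_mem_nhds hU)
  have hderiv := (hasDerivAt_lTilde hτ hu hΔ c j
    (hℓ.hasLineDerivAt_mulDeltaPow hτ hU (c / n) hf.hasLineDerivAt)).deriv
  have hexp : exp (-(c / n) * ℓ x) * exp (c / n * ℓ x) = 1 := by
    rw [← exp_add, neg_mul, neg_add_cancel, exp_zero]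
  have hgi := gaugeProd_ne_zero hΔ i
  have hgj := gaugeProd_ne_zero hΔ j
  rw [mulDeltaPow, lTildeDeriv, hderiv, mulDeltaPow, laxK]
  by_cases hij : i = j
  · subst hij
    rw [if_pos rfl, Matrix.one_apply_eq, deriv_exchangeMatrix_diag hτ hu hΔ, div_self hgi,
      ← logDeriv_apply]
    linear_combination (c / n * logDeriv (theta τ) u * f x + lineDeriv ℂ f x (epsBar i)) * hexp
  · rw [if_neg hij, Matrix.one_apply_ne (Ne.symm hij), deriv_exchangeMatrix_offDiag hτ u hΔ hij]
    have hgauge : gaugeProd τ x j / gaugeProd τ x i * (gaugeProd τ x i / gaugeProd τ x j) = 1 := by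
      field_simp
    linear_combination (exp (-(c / n) * ℓ x) * exp (c / n * ℓ x) * hgauge + hexp) *
      (c / n * (theta τ (u + coordDiff x j i) * deriv (theta τ) 0 /
        (theta τ u * theta τ (coordDiff x j i))) * f x)

end LOperator

section Krichever

variable {n : ℕ} {τ u : ℂ} {x : WeightSpace n}

/-- The expression `g (u - s) / (g u g s) exp (ζ(u) s)`, `ζ = g' / g`, which defines the Lamé
function when `g = σ`. -/
noncomputable def lameQuotient (g : ℂ → ℂ) (s u : ℂ) : ℂ :=
  g (u - s) / (g u * g s) * exp (logDeriv g u * s)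

theorem lameQuotient_cexp_mul {g : ℂ → ℂ} (hg : DifferentiableAt ℂ g u) (hu : g u ≠ 0) (h s : ℂ) :
    lameQuotient (fun v => exp (h * v ^ 2) * g v) s u = lameQuotient g s u := by
  have hgauss : HasDerivAt (fun v => exp (h * v ^ 2)) (exp (h * u ^ 2) * (2 * h * u)) u := by
    refine ((hasDerivAt_pow 2 u).const_mul h).cexp.congr_deriv ?_
    push_cast
    ring
  have hlog : logDeriv (fun v => exp (h * v ^ 2) * g v) u = 2 * h * u + logDeriv g u := by
    rw [logDeriv_mul (f := fun v => exp (h * v ^ 2)) u (exp_ne_zero _) hu hgauss.differentiableAt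
      hg, logDeriv_apply _ u, hgauss.deriv, mul_div_cancel_left₀ _ (exp_ne_zero _)]
  have hexp : exp (h * (u - s) ^ 2) * exp (2 * h * u * s) = exp (h * u ^ 2) * exp (h * s ^ 2) := by
    rw [← exp_add, ← exp_add]
    congr 1
    ring
  have hcancel : exp (h * (u - s) ^ 2) * exp (2 * h * u * s) /
      (exp (h * u ^ 2) * exp (h * s ^ 2)) = 1 := by
    rw [hexp, div_self (mul_ne_zero (exp_ne_zero _) (exp_ne_zero _))]
  simp only [lameQuotient]
  rw [hlog, add_mul, exp_add]
  linear_combination (g (u - s) / (g u * g s) * exp (logDeriv g u * s)) * hcancel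

theorem lameQuotient_div_const (g : ℂ → ℂ) (C s u : ℂ) :
    lameQuotient (fun v => g v / C) s u = C * lameQuotient g s u := by
  rcases eq_or_ne C 0 with rfl | hC
  · simp [lameQuotient]
  · simp only [lameQuotient, div_eq_mul_inv, logDeriv_mul_const _ _ (inv_ne_zero hC)]
    field_simp

theorem lamePhi_eq_mul_lameQuotient_theta (hτ : 0 < τ.im) (hu : theta τ u ≠ 0) (s : ℂ) :
    lamePhi τ s u = deriv (theta τ) 0 * lameQuotient (theta τ) s u := by
  rw [← lameQuotient_cexp_mul (differentiable_theta hτ u) hu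
    (-2 * Real.pi * I * logDeriv ModularForm.eta τ), ← lameQuotient_div_const]
  rfl

theorem hasLineDerivAt_mulExp (a : ℂ) {f : WeightSpace n → ℂ} {f' : ℂ} {i : Fin n}
    (hf : HasLineDerivAt ℂ f f' x (epsBar i)) :
    HasLineDerivAt ℂ (mulExp a i f)
      (exp (a * pairing x (epsBar i)) * (f' + a * (1 - 1 / n) * f x)) x (epsBar i) := by
  have hpairing :
      HasLineDerivAt ℂ (fun y => pairing y (epsBar i)) (1 - 1 / (n : ℂ)) x (epsBar i) := by
    simp only [HasLineDerivAt, pairing_add_smul, pairing_epsBar_epsBar, if_true]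
    exact (hasDerivAt_mul_const _).const_add _
  exact hasLineDerivAt_cexp_mul (hpairing.const_mul a) hf

theorem mulExp_laxK_mulExp (hτ : 0 < τ.im) (c : ℂ) (hu : theta τ u ≠ 0) {f : WeightSpace n → ℂ}
    {i : Fin n} (hf : LineDifferentiableAt ℂ f x (epsBar i)) (j : Fin n) :
    mulExp (logDeriv (theta τ) u) i
        (laxK τ c u i j (mulExp (-logDeriv (theta τ) u) j f)) x =
      kricheverLax τ (-(c / n)) u i j f x +
        (if i = j then (c / n - (1 - 1 / n)) * logDeriv (theta τ) u * f x else 0) := by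
  rw [mulExp, laxK, kricheverLax]
  by_cases hij : i = j
  · subst hij
    have hexp : exp (logDeriv (theta τ) u * pairing x (epsBar i)) *
        exp (-logDeriv (theta τ) u * pairing x (epsBar i)) = 1 := by
      rw [← exp_add, neg_mul, add_neg_cancel, exp_zero]
    rw [if_pos rfl, if_pos rfl, if_pos rfl, (hasLineDerivAt_mulExp _ hf.hasLineDerivAt).lineDeriv,
      mulExp, ← logDeriv_apply]
    linear_combination (c / n * logDeriv (theta τ) u * f x + lineDeriv ℂ f x (epsBar i)
      - logDeriv (theta τ) u * (1 - 1 / n) * f x) * hexp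
  · have hexp : exp (logDeriv (theta τ) u * coordDiff x i j) =
        exp (logDeriv (theta τ) u * pairing x (epsBar i)) *
          exp (-logDeriv (theta τ) u * pairing x (epsBar j)) := by
      rw [← exp_add, coordDiff_eq]
      congr 1
      ring
    rw [if_neg hij, if_neg hij, if_neg hij, mulExp, lamePhi_eq_mul_lameQuotient_theta hτ hu,
      lameQuotient, hexp, ← neg_coordDiff x i j, odd_theta, ← sub_eq_add_neg, mul_neg, div_neg]
    ring

end Krichever

end EllipticLax

theorem proposition3 (n : ℕ) (hn : 1 < n) (τ : ℂ) (hτ : 0 < τ.im) (c u : ℂ)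
    (hu : EllipticLax.theta τ u ≠ 0)
    (U : Set (EllipticLax.WeightSpace n)) (hU : IsOpen U)
    (ℓ : EllipticLax.WeightSpace n → ℂ) (hℓ : EllipticLax.IsLogDeltaBranch τ ℓ U)
    (f : EllipticLax.WeightSpace n → ℂ) (hf : DifferentiableOn ℂ f U)
    (x : EllipticLax.WeightSpace n) (hx : x ∈ U) (i j : Fin n) :
    DifferentiableAt ℂ
        (fun ħ : ℂ => EllipticLax.lTilde τ ħ c u i j (EllipticLax.mulDeltaPow ℓ (c / n) f) x) 0 ∧
      EllipticLax.gaugeProd τ x j / EllipticLax.gaugeProd τ x i *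
          EllipticLax.mulDeltaPow ℓ (-(c / n))
            (EllipticLax.lTildeDeriv τ c u i j (EllipticLax.mulDeltaPow ℓ (c / n) f)) x =
        EllipticLax.laxK τ c u i j f x ∧
      EllipticLax.mulExp (logDeriv (EllipticLax.theta τ) u) i
          (EllipticLax.laxK τ c u i j
            (EllipticLax.mulExp (-logDeriv (EllipticLax.theta τ) u) j f)) x =
        EllipticLax.kricheverLax τ (-(c / n)) u i j f x +
          (if i = j then
            (c / n - (1 - 1 / n)) * logDeriv (EllipticLax.theta τ) u * f x else 0) := by
  have hUx : U ∈ nhds x := hU.mem_nhds hx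
  have hΔ : EllipticLax.thetaDelta τ x ≠ 0 := hℓ.thetaDelta_ne_zero hx
  have hf' : LineDifferentiableAt ℂ f x (EllipticLax.epsBar i) :=
    ((hf x hx).differentiableAt hUx).lineDifferentiableAt
  have hF := hℓ.hasLineDerivAt_mulDeltaPow hτ hUx (c / n) hf'.hasLineDerivAt
  exact ⟨(EllipticLax.hasDerivAt_lTilde hτ hu hΔ c j hF).differentiableAt,
    EllipticLax.gaugeProd_div_mul_mulDeltaPow_lTildeDeriv hτ c hu hUx hℓ hf' j,
    EllipticLax.mulExp_laxK_mulExp hτ c hu hf' j⟩
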